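/- Let $\boldsymbol{A}$ be a finite Abelian algebra (i.e. $[1_A,1_A]=0_A$; equivalently, for every term $t(\vec x,\vec y)$ and all tuples $\vec a,\vec b,\vec c,\vec d$ in $A$, $t(\vec a,\vec c)=t(\vec a,\vec d)$ implies $t(\vec b,\vec c)=t(\vec b,\vec d)$) belonging to a congruence-modular variety. Assume that $|A|=p_1^{\alpha_1}p_2^{\alpha_2}\cdots p_k^{\alpha_k}$, where $p_1,\dots,p_k$ are distinct primes and $\alpha_1,\dots,\alpha_k$ are non-negative integers. Let $\boldsymbol{S}$ be a subdirectly irreducible algebra in the variety $\operatorname{Var}\boldsymbol{A}$ generated by $\boldsymbol{A}$. Then $\boldsymbol{S}$ is finite and $|S|$ divides $p_1^{\alpha_1^2}p_2^{\alpha_2^2}\cdots p_k^{\alpha_k^2}$. -/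

import Mathlib

/-! Universal algebra: algebras are structures for a first-order language without relation
symbols; terms and their evaluation are the ones of the model theory library. -/

universe u w v₁ v₂

namespace UnivAlg

open FirstOrder FirstOrder.Language

/-- A congruence of the algebra `A`: an equivalence relation compatible with all basic
operations. -/
structure Congruence (L : Language) (A : Type*) [L.Structure A] extends Setoid A where
  map_fun : ∀ {n : ℕ} (f : L.Functions n) (x y : Fin n → A),
    (∀ i, toSetoid (x i) (y i)) → toSetoid (Structure.funMap f x) (Structure.funMap f y)

namespace Congruence

variable {L : Language} {A : Type*} [L.Structure A]

theorem toSetoid_injective :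
    Function.Injective (toSetoid : Congruence L A → Setoid A) := by
  rintro ⟨s, hs⟩ ⟨t, ht⟩ h
  cases h
  rfl

/-- Congruences are ordered by inclusion: `θ ≤ φ` iff `θ a b` implies `φ a b`. -/
instance : PartialOrder (Congruence L A) := PartialOrder.lift toSetoid toSetoid_injective

/-- The intersection of a set of congruences. -/
instance : InfSet (Congruence L A) where
  sInf C :=
    { toSetoid := sInf (toSetoid '' C)
      map_fun := by
        rintro n f x y h _ ⟨θ, hθ, rfl⟩
        exact θ.map_fun f x y fun i => h i _ ⟨θ, hθ, rfl⟩ }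

theorem isGLB_sInf (C : Set (Congruence L A)) : IsGLB C (sInf C) := by
  constructor
  · intro θ hθ a b hab
    exact hab _ ⟨θ, hθ, rfl⟩
  · rintro φ hφ a b hab _ ⟨θ, hθ, rfl⟩
    exact hφ hθ hab

/-- The complete lattice of congruences of `A`; the meet is the intersection, the bottom is the
equality relation and the top is the full relation. -/
instance : CompleteLattice (Congruence L A) where
  __ := completeLatticeOfInf (Congruence L A) isGLB_sInf
  inf θ φ :=
    { toSetoid := θ.toSetoid ⊓ φ.toSetoid
      map_fun := fun f x y h =>
        ⟨θ.map_fun f x y fun i => (h i).1, φ.map_fun f x y fun i => (h i).2⟩ }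
  inf_le_left _ _ := fun _ _ h => h.1
  inf_le_right _ _ := fun _ _ h => h.2
  le_inf _ _ _ h₁ h₂ := fun _ _ h => ⟨h₁ h, h₂ h⟩
  bot :=
    { toSetoid := ⊥
      map_fun := fun f x y h => by
        have hxy : x = y := funext h
        subst hxy
        exact (⊥ : Setoid A).refl _ }
  bot_le θ := by
    intro a b hab
    have hab' : a = b := hab
    subst hab'
    exact θ.toSetoid.refl _
  top :=
    { toSetoid := ⊤
      map_fun := fun _ _ _ _ => trivial }
  le_top _ := fun _ _ _ => trivial

end Congruence

/-- An identity `s ≈ t` in the language `L`: a pair of terms in countably many variables. -/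
abbrev Identity (L : Language) := L.Term ℕ × L.Term ℕ

/-- The algebra `A` satisfies the identity `e`. -/
def Satisfies {L : Language} (A : Type*) [L.Structure A] (e : Identity L) : Prop :=
  ∀ v : ℕ → A, e.1.realize v = e.2.realize v

/-- The algebra `A` belongs to the variety (equational class) defined by the identities `V`. -/
def MemVariety {L : Language} (V : Set (Identity L)) (A : Type*) [L.Structure A] : Prop :=
  ∀ e ∈ V, Satisfies A e

/-- The variety `Var A` generated by the algebra `A`, given by all identities which hold in `A`;
it is the smallest variety containing `A`. -/
def varietyGenerated (L : Language) (A : Type*) [L.Structure A] : Set (Identity L) :=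
  {e | Satisfies A e}

/-- The variety defined by `V` is congruence-modular: the congruence lattice of each of its
members is modular. -/
def CongruenceModular {L : Language} (V : Set (Identity L)) : Prop :=
  ∀ (B : Type u) [L.Structure B], MemVariety V B → IsModularLattice (Congruence L B)

/-- The algebra `A` is Abelian (`[1, 1] = 0`), that is, it satisfies the term condition
`t(a, c) = t(a, d) → t(b, c) = t(b, d)`
for all terms `t(x, y)` in two tuples of variables and all tuples `a, b, c, d` of `A`. -/
def IsAbelian (L : Language) (A : Type*) [L.Structure A] : Prop :=
  ∀ (m n : ℕ) (t : L.Term (Fin m ⊕ Fin n)) (a b : Fin m → A) (c d : Fin n → A),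
    t.realize (Sum.elim a c) = t.realize (Sum.elim a d) →
      t.realize (Sum.elim b c) = t.realize (Sum.elim b d)

/-- The (non-empty) algebra `S` is subdirectly irreducible: it is trivial or it has a smallest
congruence (its monolith) among those different from equality. -/
def IsSubdirectlyIrreducible (L : Language) (S : Type*) [L.Structure S] : Prop :=
  Nonempty S ∧ (Subsingleton S ∨
    ∃ μ : Congruence L S, μ ≠ ⊥ ∧ ∀ θ : Congruence L S, θ ≠ ⊥ → μ ≤ θ)

end UnivAlg

/-!
Such an algebra `A` is affine, that is, polynomially equivalent to a module over a finite ring, and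
so are the members of the variety it generates. The bound is then a statement on modules.

*Affineness.* The quaternary term operations of `A` form an algebra in the given variety, so the
modular law holds for its congruences. Applied to three congruences of the kind "agree at all points
satisfying certain equations between coordinates", it links the first projection to the last one by
a chain of term operations, as in Day's characterization of congruence modularity. Going along the
chain, the term condition produces ternary terms which are closer and closer to a Mal'cev term
(`HasMalcevApprox.of_agree_outer`), and at the end of the chain there is one
(`IsAbelian.exists_malcev`). By the term condition again, a Mal'cev term `d` commutes with all terms
(`IsAbelian.malcev_comm`). These facts are identities, so they pass to every algebra in the variety
generated by `A`, and they say that `x + y = d(x, 0, y)` is an Abelian group operation for which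
`d(x, y, z) = x - y + z` is preserved by all terms (`exists_isAffine`).

*The bound.* Let `R` be the ring of the maps `x ↦ t(x, 0)` with `t` a binary term such that
`t(z, z) = z`. It acts faithfully on `A`, so `|R|` divides `|End(A, +)|`, and it acts on the
subdirectly irreducible algebra `S`. Put the zero of `S` at `b`, where `a ≠ b` are related by the
monolith, and take a character `χ : S → ℚ/ℤ` with `χ(a) ≠ 0`. The elements `s` with `χ(R s) = 0` are
the class of `0` in a congruence which does not relate `a` to `0`, hence is trivial. So `s` is
determined by the character `r ↦ χ(r s)` of `R`, which embeds `S` into the dual group of `R`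
(`IsAffine.finite_and_card_dvd`), and `|S|` divides `|R|`. Finally `|End(A, +)|` divides the product
of the `p ^ (α ^ 2)` by the decomposition of `(A, +)` into cyclic groups
(`card_addMonoidEnd_dvd`).
-/

/-! ### Finite abelian groups -/

/-- The `p ^ e`-torsion is a `p`-group, so its order divides the `p`-part of the order of `H`; it is
trivial for `e = 0`. -/
theorem card_torsion_dvd (H : Type*) [AddCommGroup H] [Finite H] {p : ℕ} (hp : p.Prime) (e : ℕ) :
    Nat.card {h : H // (p ^ e) • h = 0} ∣ p ^ ((Nat.card H).factorization p * e) := by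
  have := Fact.mk hp
  rcases Nat.eq_zero_or_pos e with rfl | he
  · have : Subsingleton {h : H // (p ^ 0) • h = 0} :=
      ⟨fun a b => Subtype.ext (by have := a.2; have := b.2; simp_all)⟩
    simp
  · let K : AddSubgroup H := (nsmulAddMonoidHom (α := H) (p ^ e)).ker
    have hK : Nat.card {h : H // (p ^ e) • h = 0} = Nat.card K := rfl
    have hpK : IsPGroup p (Multiplicative K) := by
      intro g
      refine ⟨e, ?_⟩
      apply Multiplicative.toAdd.injective
      exact Subtype.ext (g.toAdd.2 : (p ^ e) • (g.toAdd : H) = 0)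
    obtain ⟨n, hn⟩ := IsPGroup.iff_card.1 hpK
    have hn' : Nat.card K = p ^ n := hn
    rw [hK, hn']
    apply pow_dvd_pow
    have hdvd : p ^ n ∣ Nat.card H := hn' ▸ K.card_addSubgroup_dvd_card
    have := (hp.pow_dvd_iff_le_factorization Nat.card_pos.ne').1 hdvd
    nlinarith

theorem card_addMonoidHom_directSum_zmod {ι : Type} [Fintype ι] (n : ι → ℕ)
    (H : Type*) [AddCommGroup H] :
    Nat.card ((DirectSum ι fun i => ZMod (n i)) →+ H) =
      ∏ i, Nat.card {h : H // n i • h = 0} := by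
  classical
  rw [← Nat.card_pi]
  refine Nat.card_congr ((DFinsupp.liftAddHom
    (β := fun i => ZMod (n i)) (γ := H)).symm.toEquiv.trans (Equiv.piCongrRight fun i => (ZMod.lift (n i)).symm.trans ?_))
  exact (zmultiplesHom H).symm.subtypeEquiv fun f => by
    have : f (n i : ℤ) = n i • f 1 := by
      rw [← map_nsmul]; simp
    simp [this]

/-- A homomorphism out of a direct sum of cyclic groups `ℤ/pᵉ` is given by `pᵉ`-torsion elements;
for each prime `p` the exponents `e` add up to the multiplicity of `p` in the order of the group. -/
theorem card_addMonoidEnd_dvd (G : Type*) [AddCommGroup G] [Finite G] :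
    Nat.card (G →+ G) ∣
      ∏ p ∈ (Nat.card G).primeFactors, p ^ ((Nat.card G).factorization p ^ 2) := by
  classical
  obtain ⟨ι, _, p, hp, e, ⟨f⟩⟩ := AddCommGroup.equiv_directSum_zmod_of_finite G
  have : ∀ i, NeZero (p i ^ e i) := fun i => ⟨pow_ne_zero _ (hp i).ne_zero⟩
  have hG : Nat.card G = ∏ i, p i ^ e i := by
    rw [Nat.card_congr (f.trans (DirectSum.addEquivProd fun i => ZMod (p i ^ e i))).toEquiv,
      Nat.card_pi]
    simp
  have hfac : ∀ q, (Nat.card G).factorization q = ∑ i, if p i = q then e i else 0 := by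
    intro q
    rw [hG, Nat.factorization_prod_apply fun i _ => NeZero.ne _]
    refine Finset.sum_congr rfl fun i _ => ?_
    rw [(hp i).factorization_pow, Finsupp.single_apply]
  have hcard : Nat.card (G →+ G) = ∏ i, Nat.card {h : G // (p i ^ e i) • h = 0} := by
    rw [← card_addMonoidHom_directSum_zmod]
    exact Nat.card_congr f.addMonoidHomCongrLeftEquiv
  rw [hcard]
  refine (Finset.prod_dvd_prod_of_dvd _ _ fun i _ => card_torsion_dvd G (hp i) (e i)).trans
    (dvd_of_eq ?_)
  calc ∏ i, p i ^ ((Nat.card G).factorization (p i) * e i)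
      = ∏ i, ∏ q ∈ (Nat.card G).primeFactors,
          q ^ ((Nat.card G).factorization q * if p i = q then e i else 0) := by
        refine Finset.prod_congr rfl fun i _ => ?_
        by_cases hi : p i ∈ (Nat.card G).primeFactors
        · rw [Finset.prod_eq_single_of_mem _ hi]
          · simp
          · intro q _ hq
            simp [hq.symm]
        · rw [Finset.prod_eq_one]
          · simp [Finsupp.notMem_support_iff.1 (by rwa [Nat.support_factorization] :
              p i ∉ (Nat.card G).factorization.support)]
          · intro q hq
            rw [if_neg (by rintro rfl; exact hi hq)]
            simp
    _ = _ := by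
        rw [Finset.prod_comm]
        refine Finset.prod_congr rfl fun q _ => ?_
        rw [Finset.prod_pow_eq_pow_sum, ← Finset.mul_sum, ← hfac, sq]

/-- The characters `G → ℚ/ℤ` embed into the complex characters, which are as many as the elements
of `G`. -/
theorem card_characterModule_dvd (G : Type*) [AddCommGroup G] [Finite G] :
    Finite (CharacterModule G) ∧ Nat.card (CharacterModule G) ∣ Nat.card G := by
  let ρ : AddCircle (1 : ℚ) →+ AddCircle (1 : ℝ) :=
    QuotientAddGroup.map _ _ (Rat.castHom ℝ).toAddMonoidHom (by
      rintro _ ⟨n, rfl⟩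
      exact ⟨n, by simp⟩)
  have hρ : Function.Injective ρ := by
    rw [injective_iff_map_eq_zero]
    intro x
    induction x using QuotientAddGroup.induction_on with
    | H q =>
      intro h
      have h' : ((q : ℝ) : AddCircle (1 : ℝ)) = 0 := h
      obtain ⟨n, hn⟩ := (AddCircle.coe_eq_zero_iff (1 : ℝ)).1 h'
      refine (AddCircle.coe_eq_zero_iff (1 : ℚ)).2 ⟨n, ?_⟩
      have : ((n : ℚ) : ℝ) = q := by simpa using hn
      simpa using (Rat.cast_injective this : (n : ℚ) = q)
  let Φ : Multiplicative (G →+ AddCircle (1 : ℚ)) →* AddChar G ℂ :=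
    { toFun := fun c => Circle.coeHom.compAddChar
        ((AddCircle.toCircle_addChar (T := (1 : ℝ))).compAddMonoidHom (ρ.comp c.toAdd))
      map_one' := by
        ext x
        change ((AddCircle.toCircle_addChar (ρ 0) : Circle) : ℂ) = 1
        simp
      map_mul' := fun a b => by
        ext x
        change ((AddCircle.toCircle_addChar (ρ (a.toAdd x + b.toAdd x)) : Circle) : ℂ) =
          (AddCircle.toCircle_addChar (ρ (a.toAdd x)) : Circle) *
            (AddCircle.toCircle_addChar (ρ (b.toAdd x)) : Circle)
        rw [map_add, AddChar.map_add_eq_mul, Circle.coe_mul] }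
  have hΦ : Function.Injective Φ := by
    intro a b hab
    apply Multiplicative.toAdd.injective
    refine DFunLike.ext _ _ fun x => hρ (AddCircle.injective_toCircle one_ne_zero ?_)
    exact Circle.coe_injective (DFunLike.congr_fun hab x)
  have := Fintype.ofFinite G
  have h : Nat.card (AddChar G ℂ) = Nat.card G := by
    rw [Nat.card_eq_fintype_card, AddChar.card_eq, Nat.card_eq_fintype_card]
  have hfin : Finite (Multiplicative (G →+ AddCircle (1 : ℚ))) := Finite.of_injective Φ hΦ
  have hdvd := Subgroup.card_dvd_of_injective Φ hΦ
  rw [h] at hdvd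
  exact ⟨hfin, hdvd⟩

namespace UnivAlg

open FirstOrder FirstOrder.Language

/-! ### Joins of congruences -/

/-- A map of several variables respects equivalence relations as soon as it respects them in each
variable separately. -/
theorem rel_map_of_rel_update {n : ℕ} {X Y : Type*} (s : Setoid X) (r : Setoid Y)
    (F : (Fin n → X) → Y)
    (h : ∀ c i a b, s a b → r (F (Function.update c i a)) (F (Function.update c i b)))
    {x y : Fin n → X} (hxy : ∀ i, s (x i) (y i)) : r (F x) (F y) := by
  classical
  suffices H : ∀ T : Finset (Fin n), r (F x) (F (T.piecewise y x)) by
    simpa using H Finset.univ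
  intro T
  induction T using Finset.induction_on with
  | empty => simp
  | insert j T hj ih =>
    refine r.trans ih ?_
    have := h (T.piecewise y x) j (x j) (y j) (hxy j)
    rwa [← Finset.piecewise_insert, ← Finset.piecewise_eq_of_notMem T y x hj,
      Function.update_eq_self] at this

namespace Congruence

variable {L : Language} {A : Type*} [L.Structure A]

/-- The equivalence relation generated by the union of two congruences, which is their join. -/
def chain (θ φ : Congruence L A) : Congruence L A where
  toSetoid := Relation.EqvGen.setoid fun a b => θ.toSetoid a b ∨ φ.toSetoid a b
  map_fun := by
    intro n f x y h
    refine rel_map_of_rel_update _ _ (Structure.funMap f) (fun c i a b hab => ?_) h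
    have hupd : ∀ ψ : Congruence L A, ∀ a b, ψ.toSetoid a b →
        ψ.toSetoid (Structure.funMap f (Function.update c i a))
          (Structure.funMap f (Function.update c i b)) := by
      intro ψ a b hab
      refine ψ.map_fun f _ _ fun j => ?_
      by_cases hj : j = i
      · subst hj; simpa using hab
      · simp [hj]
    induction hab with
    | rel a b hab => exact .rel _ _ (hab.imp (hupd θ a b) (hupd φ a b))
    | refl a => exact .refl _
    | symm a b _ ih => exact .symm _ _ ih
    | trans a b c _ _ ih₁ ih₂ => exact .trans _ _ _ ih₁ ih₂

theorem sup_le_chain (θ φ : Congruence L A) : θ ⊔ φ ≤ chain θ φ :=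
  sup_le (fun _ _ h => Relation.EqvGen.rel _ _ (.inl h))
    (fun _ _ h => Relation.EqvGen.rel _ _ (.inr h))

end Congruence

/-! ### The algebra of term operations -/

section TermOperations

variable (L : FirstOrder.Language.{v₁, v₂}) (A : Type u) [L.Structure A] (ι : Type)

/-- The `ι`-ary term operations of `A`: the free algebra on `ι` in the variety generated by `A`,
realized as a subalgebra of a power of `A` so that it lives in the universe of `A`. -/
def TermOperation : Type u :=
  {f : (ι → A) → A // ∃ t : L.Term ι, ∀ v, f v = t.realize v}

/-- The operations are pointwise; the relations, which play no role, are empty. -/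
instance : L.Structure (TermOperation L A ι) where
  funMap f x := ⟨fun v => Structure.funMap f fun i => (x i).1 v,
    Term.func f fun i => (x i).2.choose, fun v => by
      rw [Term.realize_func]
      exact congrArg _ (funext fun i => (x i).2.choose_spec v)⟩
  RelMap _ _ := False

namespace TermOperation

variable {L A ι}

/-- The projection to the coordinate `i`. -/
def proj (i : ι) : TermOperation L A ι := ⟨fun v => v i, Term.var i, fun _ => rfl⟩

theorem realize_apply {κ : Type*} (t : L.Term κ) (v : κ → TermOperation L A ι) (a : ι → A) :
    (t.realize v).1 a = t.realize fun i => (v i).1 a := by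
  induction t with
  | var i => rfl
  | func f ts ih =>
    rw [Term.realize_func, Term.realize_func]
    change Structure.funMap f _ = _
    congr 1
    funext i
    exact ih i

theorem memVariety {V : Set (Identity L)} (h : MemVariety V A) :
    MemVariety V (TermOperation L A ι) := by
  intro e he v
  refine Subtype.ext (funext fun a => ?_)
  rw [realize_apply, realize_apply]
  exact h e he _

/-- Two term operations are congruent if they agree at all points of `P`. -/
def agreeOn (P : Set (ι → A)) : Congruence L (TermOperation L A ι) where
  r f g := ∀ v ∈ P, f.1 v = g.1 v
  iseqv := ⟨fun _ _ _ => rfl, fun h v hv => (h v hv).symm,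
    fun h₁ h₂ v hv => (h₁ v hv).trans (h₂ v hv)⟩
  map_fun f _ _ h := fun v hv => congrArg (Structure.funMap f) (funext fun i => h i v hv)

end TermOperation

end TermOperations

/-! ### The term condition and the Mal'cev term -/

section Abelian

variable {L : FirstOrder.Language.{v₁, v₂}} {A : Type u} [L.Structure A]

/-- The term condition for tuples indexed by arbitrary finite types. -/
theorem IsAbelian.term_condition (hA : IsAbelian L A) {κ₁ κ₂ : Type*} [Finite κ₁] [Finite κ₂]
    (t : L.Term (κ₁ ⊕ κ₂)) {a : κ₁ → A} (b : κ₁ → A) {c d : κ₂ → A}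
    (h : t.realize (Sum.elim a c) = t.realize (Sum.elim a d)) :
    t.realize (Sum.elim b c) = t.realize (Sum.elim b d) := by
  obtain ⟨m, ⟨e₁⟩⟩ := Finite.exists_equiv_fin κ₁
  obtain ⟨n, ⟨e₂⟩⟩ := Finite.exists_equiv_fin κ₂
  have key : ∀ (a : κ₁ → A) (c : κ₂ → A),
      (t.relabel (Sum.map e₁ e₂)).realize (Sum.elim (a ∘ e₁.symm) (c ∘ e₂.symm)) =
        t.realize (Sum.elim a c) := by
    intro a c
    rw [Term.realize_relabel, Sum.elim_comp_map, Function.comp_assoc, Function.comp_assoc]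
    simp
  have := hA m n (t.relabel (Sum.map e₁ e₂)) (a ∘ e₁.symm) (b ∘ e₁.symm) (c ∘ e₂.symm)
    (d ∘ e₂.symm)
  simp only [key] at this
  exact this h

theorem IsAbelian.change_middle (hA : IsAbelian L A) (t : L.Term (Fin 4)) {c d c' d' a a' : A}
    (b b' : A) (h : t.realize ![c, a, a', c'] = t.realize ![d, a, a', d']) :
    t.realize ![c, b, b', c'] = t.realize ![d, b, b', d'] := by
  have key : ∀ a a' c c' : A, (t.relabel ![Sum.inr 0, Sum.inl 0, Sum.inl 1, Sum.inr 1]).realize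
      (Sum.elim ![a, a'] ![c, c']) = t.realize ![c, a, a', c'] := by
    intro a a' c c'
    rw [Term.realize_relabel]
    congr 1
    funext i
    fin_cases i <;> rfl
  rw [← key, ← key] at h ⊢
  exact hA.term_condition _ _ h

theorem IsAbelian.change_third (hA : IsAbelian L A) (t : L.Term (Fin 4)) {c d c' d' c'' d'' a : A}
    (b : A) (h : t.realize ![c, c', a, c''] = t.realize ![d, d', a, d'']) :
    t.realize ![c, c', b, c''] = t.realize ![d, d', b, d''] := by
  have key : ∀ a c c' c'' : A,
      (t.relabel ![Sum.inr 0, Sum.inr 1, Sum.inl 0, Sum.inr 2]).realize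
        (Sum.elim ![a] ![c, c', c'']) = t.realize ![c, c', a, c''] := by
    intro a c c' c''
    rw [Term.realize_relabel]
    congr 1
    funext i
    fin_cases i <;> rfl
  rw [← key, ← key] at h ⊢
  exact hA.term_condition _ _ h

/-- Substitution of three terms into a ternary term. -/
def subst₃ {κ : Type*} (d : L.Term (Fin 3)) (r s t : L.Term κ) : L.Term κ := d.subst ![r, s, t]

@[simp]
theorem realize_subst₃ {S : Type*} [L.Structure S] {κ : Type*} (d : L.Term (Fin 3))
    (r s t : L.Term κ) (v : κ → S) :
    (subst₃ d r s t).realize v = d.realize ![r.realize v, s.realize v, t.realize v] := by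
  rw [subst₃, Term.realize_subst]
  congr 1
  funext i
  fin_cases i <;> rfl

/-- Substitution of four terms into a quaternary term. -/
def subst₄ {κ : Type*} (m : L.Term (Fin 4)) (q r s t : L.Term κ) : L.Term κ :=
  m.subst ![q, r, s, t]

@[simp]
theorem realize_subst₄ {S : Type*} [L.Structure S] {κ : Type*} (m : L.Term (Fin 4))
    (q r s t : L.Term κ) (v : κ → S) :
    (subst₄ m q r s t).realize v =
      m.realize ![q.realize v, r.realize v, s.realize v, t.realize v] := by
  rw [subst₄, Term.realize_subst]
  congr 1
  funext i
  fin_cases i <;> rfl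

/-- The quaternary term operation `m` satisfies `m(x, y, y, x) = x`, and some ternary term `p`
satisfies `p(x, x, z) = z` and `p(x, y, y) = m(y, u, u, x)`. For the last projection `m` this
makes `p` a Mal'cev term. -/
def HasMalcevApprox (m : TermOperation L A (Fin 4)) : Prop :=
  (∀ x y : A, m.1 ![x, y, y, x] = x) ∧ ∃ p : L.Term (Fin 3),
    (∀ x z : A, p.realize ![x, x, z] = z) ∧ ∀ x y u : A, p.realize ![x, y, y] = m.1 ![y, u, u, x]

theorem HasMalcevApprox.of_agree_middle {m m' : TermOperation L A (Fin 4)} (h : HasMalcevApprox m)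
    (hm : ∀ x y w : A, m.1 ![x, y, y, w] = m'.1 ![x, y, y, w]) : HasMalcevApprox m' := by
  obtain ⟨h₁, p, h₂, h₃⟩ := h
  exact ⟨fun x y => hm x y x ▸ h₁ x y, p, h₂, fun x y u => hm y u x ▸ h₃ x y u⟩

/-- In module terms `m(x, y, y', w) = x + δ (w - x) + β (y - y')`, and the term operation
`m(z, y, x, z) = z - β (x - y)` is a translation, with inverse `m(z, x, y, z)`. If `m` and `m'`
agree at `(y, y, x, x)`, then `δ - β = δ' - β'`, so translating by `m` and then back by `m'` turns
a term for `δ` into one for `δ'`. -/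
theorem HasMalcevApprox.of_agree_outer (hA : IsAbelian L A) {m m' : TermOperation L A (Fin 4)}
    (h : HasMalcevApprox m) (hm : ∀ x w : A, m.1 ![x, x, w, w] = m'.1 ![x, x, w, w])
    (hm' : ∀ x y : A, m'.1 ![x, y, y, x] = x) : HasMalcevApprox m' := by
  obtain ⟨h₁, p, h₂, h₃⟩ := h
  obtain ⟨t, ht⟩ := m.2
  obtain ⟨t', ht'⟩ := m'.2
  simp only [ht, ht'] at h₁ h₃ hm hm'
  -- `t(y, u, u, x)` does not depend on `u`, and `t(z, y, x, z)` sends it to `t(y, y, x, x)`.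
  have translate : ∀ t : L.Term (Fin 4), (∀ x y : A, t.realize ![x, y, y, x] = x) →
      ∀ x y u : A, t.realize ![t.realize ![y, u, u, x], y, x, t.realize ![y, u, u, x] ] =
        t.realize ![y, y, x, x] := fun t ht x y u =>
    hA.change_middle t (a := u) (a' := u) _ _ (ht _ _)
  have translate_back : ∀ t : L.Term (Fin 4), (∀ x y : A, t.realize ![x, y, y, x] = x) →
      ∀ x y s : A, t.realize ![t.realize ![s, y, x, s], x, y, t.realize ![s, y, x, s] ] = s :=
    fun t ht x y s => (hA.change_third t (a := x) y (ht _ _)).trans (ht _ _)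
  refine ⟨fun x y => by rw [ht', hm'], subst₄ t' (subst₄ t p (.var 1) (.var 0) p) (.var 0) (.var 1)
    (subst₄ t p (.var 1) (.var 0) p), fun x z => ?_, fun x y u => ?_⟩
  · simp [h₁, h₂, hm']
  · rw [ht']
    simp only [realize_subst₄, Term.realize_var]
    simp only [Matrix.cons_val_zero, Matrix.cons_val_one, h₃ x y u]
    rw [translate t h₁, hm, ← translate t' hm' x y u, translate_back t' hm']

/-- The modular law is applied to the congruences of agreement at the points `(x, x, w, w)`, at the
points `(x, y, y, x)` and at the points `(x, y, y, w)`. -/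
theorem IsAbelian.exists_malcev (hA : IsAbelian L A) {V : Set (Identity L)}
    (hV : CongruenceModular.{u} V) (hAV : MemVariety V A) :
    ∃ d : L.Term (Fin 3), ∀ x y : A, d.realize ![x, y, y] = x ∧ d.realize ![x, x, y] = y := by
  -- Modularity gives `(γ ⊔ α) ⊓ β = γ ⊔ (α ⊓ β)`, and the left side relates the outer projections.
  let α : Congruence L (TermOperation L A (Fin 4)) :=
    TermOperation.agreeOn {v | v 0 = v 1 ∧ v 2 = v 3}
  let β : Congruence L (TermOperation L A (Fin 4)) :=
    TermOperation.agreeOn {v | v 0 = v 3 ∧ v 1 = v 2}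
  let γ : Congruence L (TermOperation L A (Fin 4)) := TermOperation.agreeOn {v | v 1 = v 2}
  have hγβ : γ ≤ β := fun f g h v hv => h v hv.2
  have hmod := hV _ (TermOperation.memVariety (ι := Fin 4) hAV)
  have hle : (γ ⊔ α) ⊓ β ≤ Congruence.chain γ (α ⊓ β) :=
    (hmod.sup_inf_le_assoc_of_le α hγβ).trans (Congruence.sup_le_chain _ _)
  have hα : α ≤ γ ⊔ α := le_sup_right
  have hγ : γ ≤ γ ⊔ α := le_sup_left
  have h03 : (Congruence.chain γ (α ⊓ β)).toSetoid (TermOperation.proj 0)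
      (TermOperation.proj 3) := by
    refine hle ⟨?_, fun v hv => hv.1⟩
    have h01 : α.toSetoid (TermOperation.proj 0) (TermOperation.proj 1) := fun v hv => hv.1
    have h12 : γ.toSetoid (TermOperation.proj 1) (TermOperation.proj 2) := fun v hv => hv
    have h23 : α.toSetoid (TermOperation.proj 2) (TermOperation.proj 3) := fun v hv => hv.2
    exact Setoid.trans' _ (hα h01) (Setoid.trans' _ (hγ h12) (hα h23))
  have step : ∀ f g, (γ.toSetoid f g ∨ (α ⊓ β).toSetoid f g) →
      HasMalcevApprox f → HasMalcevApprox g := by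
    rintro f g (h | h) hf
    · exact hf.of_agree_middle fun x y w => h _ rfl
    · refine hf.of_agree_outer hA (fun x w => h.1 _ ⟨rfl, rfl⟩) fun x y => ?_
      exact (h.2 _ ⟨rfl, rfl⟩).symm.trans (hf.1 x y)
  have chain : ∀ f g, (Congruence.chain γ (α ⊓ β)).toSetoid f g →
      (HasMalcevApprox f ↔ HasMalcevApprox g) := by
    intro f g h
    induction h with
    | rel f g h =>
      exact ⟨step f g h, step g f (h.imp (Setoid.symm' _) (Setoid.symm' _))⟩
    | refl f => exact Iff.rfl
    | symm f g _ ih => exact ih.symm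
    | trans f g h _ _ ih₁ ih₂ => exact ih₁.trans ih₂
  have h0 : HasMalcevApprox (TermOperation.proj 0 : TermOperation L A (Fin 4)) :=
    ⟨fun _ _ => rfl, Term.var 2, fun _ _ => rfl, fun _ _ _ => rfl⟩
  obtain ⟨-, p, hp, hp'⟩ := (chain _ _ h03).1 h0
  exact ⟨p, fun x y => ⟨hp' x y x, hp x y⟩⟩

/-- In an Abelian algebra a Mal'cev term commutes with all terms. -/
theorem IsAbelian.malcev_comm (hA : IsAbelian L A) {d : L.Term (Fin 3)}
    (hd : ∀ x y : A, d.realize ![x, y, y] = x ∧ d.realize ![x, x, y] = y) {n : ℕ}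
    (t : L.Term (Fin n)) (x y z : Fin n → A) :
    d.realize ![t.realize x, t.realize y, t.realize z] =
      t.realize fun i => d.realize ![x i, y i, z i] := by
  -- Let `G` and `H` be the two sides. The term `d(G, H, w)` has the value `w` if `x = y`, hence
  -- does not depend on `z` if `x = y`, hence never; and if `y = z` its value is `w` again.
  let jx : Fin n → Fin n ⊕ (Fin n ⊕ (Fin n ⊕ Unit)) := Sum.inl
  let jy : Fin n → Fin n ⊕ (Fin n ⊕ (Fin n ⊕ Unit)) := Sum.inr ∘ Sum.inl
  let jz : Fin n → Fin n ⊕ (Fin n ⊕ (Fin n ⊕ Unit)) := Sum.inr ∘ Sum.inr ∘ Sum.inl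
  let K : L.Term (Fin n ⊕ (Fin n ⊕ (Fin n ⊕ Unit))) :=
    subst₃ d (subst₃ d (t.relabel jx) (t.relabel jy) (t.relabel jz))
      (t.subst fun i => subst₃ d (.var (jx i)) (.var (jy i)) (.var (jz i)))
      (.var (Sum.inr (Sum.inr (Sum.inr ()))))
  have hK : ∀ (x y z : Fin n → A) (w : A),
      K.realize (Sum.elim x (Sum.elim y (Sum.elim z fun _ => w))) =
        d.realize ![d.realize ![t.realize x, t.realize y, t.realize z],
          t.realize fun i => d.realize ![x i, y i, z i], w] := by
    intro x y z w
    simp only [K, realize_subst₃, Term.realize_relabel, Term.realize_subst, Term.realize_var]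
    rfl
  have key : ∀ w, K.realize (Sum.elim x (Sum.elim y (Sum.elim z fun _ => w))) =
      K.realize (Sum.elim x (Sum.elim y (Sum.elim y fun _ => w))) := fun w =>
    hA.term_condition K (a := y) x (by simp [hK, hd])
  have := key (t.realize fun i => d.realize ![x i, y i, z i])
  simpa [hK, hd] using this

end Abelian

/-! ### Affine algebras -/

/-- The algebra `A`, which carries an Abelian group structure, is affine with difference term `d`:
the term `d` is the operation `x - y + z`, and all terms preserve this operation. -/
structure IsAffine {L : FirstOrder.Language.{v₁, v₂}} (d : L.Term (Fin 3)) (A : Type*)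
    [L.Structure A] [AddCommGroup A] : Prop where
  realize_eq : ∀ x y z : A, d.realize ![x, y, z] = x - y + z
  realize_sub_add : ∀ (n : ℕ) (t : L.Term (Fin n)) (x y z : Fin n → A),
    t.realize (x - y + z) = t.realize x - t.realize y + t.realize z

/-- The Abelian group `x + y = d(x, o, y)` of a Mal'cev operation `d` which commutes with itself,
with the zero element `o`. -/
abbrev malcevAddCommGroup {X : Type*} (d : X → X → X → X) (h₁ : ∀ x y, d x y y = x)
    (h₂ : ∀ x y, d x x y = y)
    (hd : ∀ x₁ x₂ x₃ y₁ y₂ y₃ z₁ z₂ z₃, d (d x₁ x₂ x₃) (d y₁ y₂ y₃) (d z₁ z₂ z₃) =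
      d (d x₁ y₁ z₁) (d x₂ y₂ z₂) (d x₃ y₃ z₃)) (o : X) : AddCommGroup X where
  add x y := d x o y
  zero := o
  neg x := d o x o
  nsmul := @nsmulRec X ⟨o⟩ ⟨fun x y => d x o y⟩
  zsmul := @zsmulRec X ⟨o⟩ ⟨fun x y => d x o y⟩ ⟨fun x => d o x o⟩
    (@nsmulRec X ⟨o⟩ ⟨fun x y => d x o y⟩)
  add_assoc x y z := by
    change d (d x o y) o z = d x o (d y o z)
    simpa only [h₁, h₂] using hd x o y o o o o o z
  zero_add x := h₂ o x
  add_zero x := h₁ x o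
  neg_add_cancel x := by
    change d (d o x o) o x = o
    simpa only [h₁, h₂] using hd o x o o o o o o x
  add_comm x y := by
    change d x o y = d y o x
    simpa only [h₁, h₂] using hd o o x o o o y o o

/-- Evaluation of an identity over an arbitrary countable set of variables. -/
theorem realize_eq_of_memVariety {L : FirstOrder.Language.{v₁, v₂}} {A : Type u} {S : Type w}
    [L.Structure A] [L.Structure S] [Nonempty S]
    (hS : MemVariety (varietyGenerated L A) S) {κ : Type*} [Countable κ] {s t : L.Term κ}
    (h : ∀ v : κ → A, s.realize v = t.realize v) (v : κ → S) : s.realize v = t.realize v := by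
  obtain ⟨e, he⟩ := exists_injective_nat κ
  have hmem : (s.relabel e, t.relabel e) ∈ varietyGenerated L A := fun v => by
    simp only [Term.realize_relabel]
    exact h _
  have := hS _ hmem (Function.extend e v fun _ => Classical.arbitrary S)
  simpa only [Term.realize_relabel, Function.extend_comp he] using this

section Affine

variable {L : FirstOrder.Language.{v₁, v₂}} {d : L.Term (Fin 3)}

theorem exists_isAffine {S : Type*} [L.Structure S]
    (hd : ∀ x y : S, d.realize ![x, y, y] = x ∧ d.realize ![x, x, y] = y)
    (hcomm : ∀ (n : ℕ) (t : L.Term (Fin n)) (x y z : Fin n → S),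
      d.realize ![t.realize x, t.realize y, t.realize z] =
        t.realize fun i => d.realize ![x i, y i, z i]) (o : S) :
    ∃ _ : AddCommGroup S, IsAffine d S ∧ o = 0 := by
  let D : S → S → S → S := fun x y z => d.realize ![x, y, z]
  have h₁ : ∀ x y, D x y y = x := fun x y => (hd x y).1
  have h₂ : ∀ x y, D x x y = y := fun x y => (hd x y).2
  have hD : ∀ x₁ x₂ x₃ y₁ y₂ y₃ z₁ z₂ z₃, D (D x₁ x₂ x₃) (D y₁ y₂ y₃) (D z₁ z₂ z₃) =
      D (D x₁ y₁ z₁) (D x₂ y₂ z₂) (D x₃ y₃ z₃) := by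
    intro x₁ x₂ x₃ y₁ y₂ y₃ z₁ z₂ z₃
    refine (hcomm 3 d ![x₁, x₂, x₃] ![y₁, y₂, y₃] ![z₁, z₂, z₃]).trans ?_
    change _ = d.realize _
    congr 1
    funext i
    fin_cases i <;> rfl
  let inst : AddCommGroup S := malcevAddCommGroup D h₁ h₂ hD o
  have hsub : ∀ x y z : S, d.realize ![x, y, z] = x - y + z := by
    intro x y z
    have e₁ : D x o (D o y o) = D x y o := by simpa only [h₁, h₂] using hD x o o o o o o y o
    have e₂ : D (D x y o) o z = D x y z := by simpa only [h₁, h₂] using hD x y o o o o o o z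
    rw [sub_eq_add_neg]
    change D x y z = D (D x o (D o y o)) o z
    rw [e₁, e₂]
  refine ⟨inst, ⟨hsub, fun n t x y z => ?_⟩, rfl⟩
  rw [← hsub, hcomm]
  congr 1
  funext i
  exact (hsub _ _ _).symm

/-! ### The ring of scalars -/

/-- The term `t(t'(x, z), z)`. -/
def substFst (t t' : L.Term (Fin 2)) : L.Term (Fin 2) := t.subst ![t', .var 1]

@[simp]
theorem realize_substFst {S : Type*} [L.Structure S] (t t' : L.Term (Fin 2)) (x z : S) :
    (substFst t t').realize ![x, z] = t.realize ![t'.realize ![x, z], z] := by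
  rw [substFst, Term.realize_subst]
  congr 1
  funext i
  fin_cases i <;> rfl

/-- The binary term `f(z, …, z, x, z, …, z)` with `x` in the position `i`. -/
def coordTerm {n : ℕ} (f : L.Functions n) (i : Fin n) : L.Term (Fin 2) :=
  Term.func f (Function.update (fun _ => .var 1) i (.var 0))

@[simp]
theorem realize_coordTerm {S : Type*} [L.Structure S] {n : ℕ} (f : L.Functions n) (i : Fin n)
    (x z : S) : (coordTerm f i).realize ![x, z] =
      Structure.funMap f (Function.update (fun _ => z) i x) := by
  rw [coordTerm, Term.realize_func]
  congr 1
  funext j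
  by_cases hj : j = i
  · subst hj; simp
  · simp [hj]

namespace IsAffine

variable {A S : Type*} [L.Structure A] [AddCommGroup A] [L.Structure S] [AddCommGroup S]

theorem realize_add (hA : IsAffine d A) {t : L.Term (Fin 2)} (ht : ∀ z : A, t.realize ![z, z] = z)
    (x y : A) : t.realize ![x + y, 0] = t.realize ![x, 0] + t.realize ![y, 0] := by
  have := hA.realize_sub_add 2 t ![x, 0] ![0, 0] ![y, 0]
  rw [ht, sub_zero] at this
  simpa using this

theorem realize_pair (hA : IsAffine d A) {t : L.Term (Fin 2)} (ht : ∀ z : A, t.realize ![z, z] = z)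
    (x z : A) : t.realize ![x, z] = t.realize ![x - z, 0] + z := by
  have := hA.realize_sub_add 2 t ![x - z, 0] ![0, 0] ![z, z]
  rw [ht, ht, sub_zero] at this
  simpa using this

/-- The endomorphism `x ↦ t(x, 0)` given by an idempotent binary term `t`. -/
def scalar (hA : IsAffine d A) (t : L.Term (Fin 2)) (ht : ∀ z : A, t.realize ![z, z] = z) :
    A →+ A where
  toFun x := t.realize ![x, 0]
  map_zero' := ht 0
  map_add' := hA.realize_add ht

/-- The ring of the affine algebras `A` and `S`: the endomorphisms `x ↦ t(x, 0)` for the binary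
terms `t` with `t(z, z) = z`. The ring is encoded by its simultaneous action on `A` and on `S`. -/
def scalars (hA : IsAffine d A) (hS : IsAffine d S) : AddSubgroup ((A →+ A) × (S →+ S)) where
  carrier := {q | ∃ t : L.Term (Fin 2), (∀ z : A, t.realize ![z, z] = z) ∧
    (∀ z : S, t.realize ![z, z] = z) ∧ (∀ x, q.1 x = t.realize ![x, 0]) ∧
    ∀ s, q.2 s = t.realize ![s, 0]}
  zero_mem' := ⟨.var 1, fun _ => rfl, fun _ => rfl, fun _ => rfl, fun _ => rfl⟩
  add_mem' := by
    rintro q q' ⟨t, h₁, h₂, h₃, h₄⟩ ⟨t', h₁', h₂', h₃', h₄'⟩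
    refine ⟨subst₃ d t (.var 1) t', fun z => ?_, fun z => ?_, fun x => ?_, fun x => ?_⟩ <;>
      simp [hA.realize_eq, hS.realize_eq, *]
  neg_mem' := by
    rintro q ⟨t, h₁, h₂, h₃, h₄⟩
    refine ⟨subst₃ d (.var 1) t (.var 1), fun z => ?_, fun z => ?_, fun x => ?_, fun x => ?_⟩ <;>
      simp [hA.realize_eq, hS.realize_eq, *]

theorem one_mem_scalars (hA : IsAffine d A) (hS : IsAffine d S) :
    (AddMonoidHom.id A, AddMonoidHom.id S) ∈ hA.scalars hS :=
  ⟨.var 0, fun _ => rfl, fun _ => rfl, fun _ => rfl, fun _ => rfl⟩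

theorem comp_mem_scalars (hA : IsAffine d A) (hS : IsAffine d S) {q r : (A →+ A) × (S →+ S)}
    (hq : q ∈ hA.scalars hS) (hr : r ∈ hA.scalars hS) :
    (q.1.comp r.1, q.2.comp r.2) ∈ hA.scalars hS := by
  obtain ⟨t, h₁, h₂, h₃, h₄⟩ := hq
  obtain ⟨t', h₁', h₂', h₃', h₄'⟩ := hr
  exact ⟨substFst t t', fun z => by simp [*], fun z => by simp [*], fun x => by simp [*],
    fun x => by simp [*]⟩

/-- A scalar which vanishes on `A` vanishes on every algebra in the variety of `A`. -/
theorem scalars_fst_injective (hA : IsAffine d A) (hS : IsAffine d S)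
    (hSA : MemVariety (varietyGenerated L A) S) :
    Function.Injective ((AddMonoidHom.fst (A →+ A) (S →+ S)).comp (hA.scalars hS).subtype) := by
  rw [injective_iff_map_eq_zero]
  rintro ⟨⟨q, q'⟩, t, h₁, h₂, h₃, h₄⟩ hq
  have hq : q = 0 := hq
  have hid : ∀ v : Fin 2 → A, t.realize v = (Term.var 1 : L.Term (Fin 2)).realize v := by
    intro v
    have hv : v = ![v 0, v 1] := by
      funext i
      fin_cases i <;> rfl
    rw [hv, hA.realize_pair h₁, ← h₃, hq]
    simp
  have : q' = 0 := by
    ext s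
    rw [h₄, realize_eq_of_memVariety hSA hid]
    rfl
  exact Subtype.ext (Prod.ext hq this)

theorem card_scalars_dvd [Finite A] (hA : IsAffine d A) (hS : IsAffine d S)
    (hSA : MemVariety (varietyGenerated L A) S) :
    Finite (hA.scalars hS) ∧ Nat.card (hA.scalars hS) ∣ Nat.card (A →+ A) := by
  have hinj := hA.scalars_fst_injective hS hSA
  have : Finite (A →+ A) := DFunLike.finite _
  exact ⟨Finite.of_injective _ hinj, AddSubgroup.card_dvd_of_injective _ hinj⟩

/-- Changing one argument of a basic operation changes the value by a scalar multiple of the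
change of the argument. -/
theorem exists_scalar_funMap_update (hA : IsAffine d A) (hS : IsAffine d S) {n : ℕ}
    (f : L.Functions n) (i : Fin n) :
    ∃ r ∈ hA.scalars hS, ∀ (c : Fin n → S) (a b : S),
      Structure.funMap f (Function.update c i a) - Structure.funMap f (Function.update c i b) =
        r.2 a - r.2 b := by
  -- The scalar is given by `f(z, …, x, …, z) - f(z, …, z) + z`.
  let t : L.Term (Fin 2) := subst₃ d (coordTerm f i) (substFst (coordTerm f i) (.var 1)) (.var 1)
  have hidA : ∀ z : A, t.realize ![z, z] = z := fun z => by simp [t, hA.realize_eq]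
  have hidS : ∀ z : S, t.realize ![z, z] = z := fun z => by simp [t, hS.realize_eq]
  refine ⟨(hA.scalar t hidA, hS.scalar t hidS),
    ⟨t, hidA, hidS, fun _ => rfl, fun _ => rfl⟩, fun c a b => ?_⟩
  have hr : ∀ x, hS.scalar t hidS x = Structure.funMap f (Function.update 0 i x) -
      Structure.funMap f (0 : Fin n → S) := by
    intro x
    change t.realize ![x, 0] = _
    simp [t, hS.realize_eq, Pi.zero_def]
  have hc : Function.update c i a = Function.update c i b -
      Function.update (0 : Fin n → S) i b + Function.update (0 : Fin n → S) i a := by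
    funext j
    by_cases hj : j = i
    · subst hj; simp
    · simp [hj]
  have hf := hS.realize_sub_add n f.term (Function.update c i b) (Function.update 0 i b)
    (Function.update 0 i a)
  rw [← hc] at hf
  simp only [Term.realize_function_term] at hf
  change _ = hS.scalar t hidS a - hS.scalar t hidS b
  rw [hf, hr, hr]
  abel

/-! ### Characters and subdirectly irreducible algebras -/

/-- For a character `χ` of `S`, the equivalence relation which relates two elements if no scalar
multiple of their difference is distinguished from `0` by `χ`. -/
def characterSetoid (hA : IsAffine d A) (hS : IsAffine d S) (χ : CharacterModule S) :
    Setoid S where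
  r x y := ∀ r ∈ hA.scalars hS, χ (r.2 x) = χ (r.2 y)
  iseqv := ⟨fun _ _ _ => rfl, fun h r hr => (h r hr).symm,
    fun h₁ h₂ r hr => (h₁ r hr).trans (h₂ r hr)⟩

/-- The relation `characterSetoid` is a congruence: a basic operation acts on a change of one
argument by a scalar, and the scalars are closed under composition. -/
def characterCongruence (hA : IsAffine d A) (hS : IsAffine d S) (χ : CharacterModule S) :
    Congruence L S where
  toSetoid := hA.characterSetoid hS χ
  map_fun f _ _ h := by
    refine rel_map_of_rel_update (hA.characterSetoid hS χ) (hA.characterSetoid hS χ)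
      (Structure.funMap f) (fun c i a b hab r hr => ?_) h
    obtain ⟨r', hr', hf⟩ := hA.exists_scalar_funMap_update hS f i
    have := hab _ (hA.comp_mem_scalars hS hr hr')
    rw [← sub_eq_zero, ← map_sub, ← map_sub, hf, map_sub, map_sub, sub_eq_zero]
    exact this

/-- If a monolith relates `a` to `0`, then a character which does not vanish at `a` gives an
embedding of `S` into the characters of the ring of scalars. -/
theorem finite_and_card_dvd [Finite A] (hA : IsAffine d A) (hS : IsAffine d S)
    (hSA : MemVariety (varietyGenerated L A) S) {μ : Congruence L S}
    (hμ : ∀ θ : Congruence L S, θ ≠ ⊥ → μ ≤ θ) {a : S} (ha : a ≠ 0) (haμ : μ.toSetoid a 0) :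
    Finite S ∧ Nat.card S ∣ Nat.card (A →+ A) := by
  obtain ⟨χ, hχ⟩ := CharacterModule.exists_character_apply_ne_zero_of_ne_zero ha
  have hbot : hA.characterCongruence hS χ = ⊥ := by
    by_contra h
    have := hμ _ h haμ _ (hA.one_mem_scalars hS)
    exact hχ (by simpa using this)
  let Φ : S →+ (hA.scalars hS →+ AddCircle (1 : ℚ)) := AddMonoidHom.mk'
    (fun s => (χ : S →+ AddCircle (1 : ℚ)).comp
      (((AddMonoidHom.eval s).comp (AddMonoidHom.snd _ _)).comp (hA.scalars hS).subtype))
    (fun s s' => by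
      ext r
      change χ (r.1.2 (s + s')) = χ (r.1.2 s) + χ (r.1.2 s')
      rw [map_add, map_add])
  have hΦ : Function.Injective Φ := by
    intro s s' h
    have hss : (hA.characterCongruence hS χ).toSetoid s s' := fun r hr =>
      DFunLike.congr_fun h ⟨r, hr⟩
    rw [hbot] at hss
    exact hss
  obtain ⟨hfin, hcard⟩ := hA.card_scalars_dvd hS hSA
  obtain ⟨hfin', hcard'⟩ := card_characterModule_dvd (hA.scalars hS)
  have : Finite (hA.scalars hS →+ AddCircle (1 : ℚ)) := hfin'
  exact ⟨Finite.of_injective Φ hΦ,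
    (AddSubgroup.card_dvd_of_injective Φ hΦ).trans (hcard'.trans hcard)⟩

end IsAffine

end Affine

end UnivAlg

theorem mainTheorem5 (L : FirstOrder.Language.{v₁, v₂}) [L.IsAlgebraic]
    (A : Type u) [L.Structure A] [Finite A]
    (V : Set (UnivAlg.Identity L)) (hV : UnivAlg.CongruenceModular.{u} V)
    (hAV : UnivAlg.MemVariety V A) (hA : UnivAlg.IsAbelian L A)
    (k : ℕ) (p α : Fin k → ℕ) (hp : ∀ i, (p i).Prime) (hp_inj : Function.Injective p)
    (hcard : Nat.card A = ∏ i, p i ^ α i)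
    (S : Type w) [L.Structure S]
    (hSV : UnivAlg.MemVariety (UnivAlg.varietyGenerated L A) S)
    (hS : UnivAlg.IsSubdirectlyIrreducible L S) :
    Finite S ∧ Nat.card S ∣ ∏ i, p i ^ (α i ^ 2) := by
  open UnivAlg FirstOrder FirstOrder.Language in
  obtain ⟨hne, hsub | ⟨μ, hμ, hμ'⟩⟩ := hS
  · have : Unique S := ⟨⟨hne.some⟩, fun _ => Subsingleton.elim _ _⟩
    exact ⟨inferInstance, by simp⟩
  have hA₀ : Nat.card A ≠ 0 := by
    rw [hcard]
    exact Finset.prod_ne_zero_iff.2 fun i _ => pow_ne_zero _ (hp i).ne_zero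
  have : Nonempty A := (Nat.card_ne_zero.1 hA₀).1
  -- The monolith relates two distinct elements `a` and `b`; the zero of `S` is put at `b`.
  obtain ⟨a, b, hab, hne'⟩ : ∃ a b, μ.toSetoid a b ∧ a ≠ b := by
    by_contra! h
    exact hμ (le_bot_iff.1 fun a b hab => h a b hab)
  obtain ⟨d, hd⟩ := hA.exists_malcev hV hAV
  have hcomm := fun n t => hA.malcev_comm hd (n := n) t
  have hdS : ∀ x y : S, d.realize ![x, y, y] = x ∧ d.realize ![x, x, y] = y := by
    intro x y
    have h₁ := realize_eq_of_memVariety hSV (s := subst₃ d (.var 0) (.var 1) (.var 1))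
      (t := (.var 0 : L.Term (Fin 2))) (fun v => by simp [hd]) ![x, y]
    have h₂ := realize_eq_of_memVariety hSV (s := subst₃ d (.var 0) (.var 0) (.var 1))
      (t := (.var 1 : L.Term (Fin 2))) (fun v => by simp [hd]) ![x, y]
    simpa using And.intro h₁ h₂
  have hcommS : ∀ (n : ℕ) (t : L.Term (Fin n)) (x y z : Fin n → S),
      d.realize ![t.realize x, t.realize y, t.realize z] =
        t.realize fun i => d.realize ![x i, y i, z i] := by
    intro n t x y z
    let jx : Fin n → Fin n ⊕ (Fin n ⊕ Fin n) := Sum.inl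
    let jy : Fin n → Fin n ⊕ (Fin n ⊕ Fin n) := Sum.inr ∘ Sum.inl
    let jz : Fin n → Fin n ⊕ (Fin n ⊕ Fin n) := Sum.inr ∘ Sum.inr
    have h := realize_eq_of_memVariety hSV
      (s := subst₃ d (t.relabel jx) (t.relabel jy) (t.relabel jz))
      (t := t.subst fun i => subst₃ d (.var (jx i)) (.var (jy i)) (.var (jz i)))
      (fun v => by
        simp only [realize_subst₃, Term.realize_relabel, Term.realize_subst, Term.realize_var]
        exact hcomm n t _ _ _)
      (Sum.elim x (Sum.elim y z))
    simp only [realize_subst₃, Term.realize_relabel, Term.realize_subst, Term.realize_var] at h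
    exact h
  obtain ⟨_, hAaff, -⟩ := exists_isAffine hd hcomm (Classical.arbitrary A)
  obtain ⟨_, hSaff, rfl⟩ := exists_isAffine hdS hcommS b
  obtain ⟨hfin, hdvd⟩ := hAaff.finite_and_card_dvd hSaff hSV hμ' hne' hab
  refine ⟨hfin, hdvd.trans ((card_addMonoidEnd_dvd A).trans ?_)⟩
  have hfac : ∀ i, (Nat.card A).factorization (p i) = α i := by
    intro i
    rw [hcard, Nat.factorization_prod_apply fun j _ => pow_ne_zero _ (hp j).ne_zero,
      Finset.sum_eq_single_of_mem i (Finset.mem_univ i)]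
    · simp [(hp i).factorization_pow]
    · intro j _ hj
      simp [(hp j).factorization_pow, hp_inj.ne hj]
  have hsubset : (Nat.card A).primeFactors ⊆ Finset.univ.image p := by
    intro q hq
    have hq' := Nat.prime_of_mem_primeFactors hq
    have hdvd := Nat.dvd_of_mem_primeFactors hq
    rw [hcard] at hdvd
    obtain ⟨i, -, hi⟩ := (hq'.prime.dvd_finsetProd_iff _).1 hdvd
    exact Finset.mem_image.2 ⟨i, Finset.mem_univ i,
      ((Nat.prime_dvd_prime_iff_eq hq' (hp i)).1 (hq'.dvd_of_dvd_pow hi)).symm⟩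
  refine (Finset.prod_dvd_prod_of_subset _ _ _ hsubset).trans (dvd_of_eq ?_)
  rw [Finset.prod_image fun i _ j _ h => hp_inj h]
  simp only [hfac]
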